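/- All graphs are finite, simple and undirected. For a graph $G=(V,E)$ let $N(G)$ be the number of nonempty subsets $S\subseteq V$ whose induced subgraph $G[S]$ is connected. A graph $G$ is bicyclic if it is connected and $|E|=|V|+1$. For $n\ge 6$, let $B_n$ be the $n$-vertex graph obtained from $K_4$ minus an edge by attaching $n-4$ pendant edges, all at the same vertex $w$ of degree $3$, and let $R_n$ be the $n$-vertex graph obtained from two triangles sharing exactly one vertex $w$ by attaching $n-5$ pendant edges at $w$. **Theorem.** Let $n\ge 8$. The graphs $B_n$ and $R_n$ are bicyclic, with $$N(B_n)=2^{n-1}+n+2,\qquad N(R_n)=2^{n-1}+n+1 .$$ Every bicyclic graph $G$ on $n$ vertices satisfies $N(G)\le N(B_n)$, with equality if and only if $G$ is isomorphic to $B_n$. Moreover, every bicyclic graph $G$ on $n$ vertices that is not isomorphic to $B_n$ satisfies $N(G)\le N(R_n)$; thus $R_n$ attains the second-largest value of $N$ among the $n$-vertex bicyclic graphs. -/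

import Mathlib

/-- The number of connected sets of `G`: sets `S` of vertices such that the induced subgraph
`G[S]` is connected. (`SimpleGraph.Connected` includes nonemptiness, so `S = ∅` is not counted.) -/
noncomputable def SimpleGraph.numConnectedSets {V : Type*} (G : SimpleGraph V) : ℕ :=
  {S : Set V | (G.induce S).Connected}.ncard

/-- A (finite) graph is bicyclic if it is connected and has exactly one more edge than vertices. -/
def SimpleGraph.IsBicyclic {V : Type*} (G : SimpleGraph V) : Prop :=
  G.Connected ∧ G.edgeSet.ncard = Nat.card V + 1

/-- The graph `B_n` (for `4 ≤ n`) on `{0, …, n - 1}`. The vertices `0, 1, 2, 3` span `K₄` minus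
the edge `13`; the vertex `0` has degree `3` there, and each of the remaining `n - 4` vertices is
joined to `0` only. -/
def bicyclicB (n : ℕ) : SimpleGraph (Fin n) :=
  SimpleGraph.fromRel fun i j =>
    i.val = 0 ∨ (i.val = 1 ∧ j.val = 2) ∨ (i.val = 2 ∧ j.val = 3)

/-- The graph `R_n` (for `5 ≤ n`) on `{0, …, n - 1}`. The triangles `0, 1, 2` and `0, 3, 4` share
the vertex `0`, and each of the remaining `n - 5` vertices is joined to `0` only. -/
def bicyclicR (n : ℕ) : SimpleGraph (Fin n) :=
  SimpleGraph.fromRel fun i j =>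
    i.val = 0 ∨ (i.val = 1 ∧ j.val = 2) ∨ (i.val = 3 ∧ j.val = 4)

/-!
Write `N` for the number of connected sets and `n` for the number of vertices.

Suppose first that some vertex `u` is adjacent to all others. Every set that contains `u` is
connected, which accounts for `2 ^ (n - 1)` sets. A bicyclic graph has exactly two edges that avoid
`u`, and a connected set that avoids `u` is a singleton or a union of some of these two edges. If
they share a vertex, the graph is `bicyclicB n` and there are `(n - 1) + 3` such sets; if they are
disjoint, there are `(n - 1) + 2`, as for `bicyclicR n`.

It remains to prove `N(G) ≤ 2 ^ (n - 1) + n + 1` if no vertex is dominating. This rests on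
contraction. For every edge `ab`, identifying `a` and `b` maps the connected sets that contain both
or neither of them injectively to connected sets of the contracted graph `G / ab`, so that
`N(G) ≤ N(G / ab) + (number of connected sets that contain exactly one of a and b)`
(`SimpleGraph.exists_contraction`). Contraction keeps the graph connected, and it keeps the number
of edges at most one more than the number of vertices. For `n ≥ 6` an edge `ab` can be chosen with
at most `2 ^ (n - 2) - (n - 6)` connected sets that contain exactly one of `a` and `b`
(`SimpleGraph.exists_adj_ncard_connectedSetsSep_le`):

* If `v` is a leaf at `u`, then only `{v}` contains `v` but not `u`. Since `u` is not dominating,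
  enough of the sets that contain `u` but not `v` are disconnected, already among those with two or
  three elements.
* If all degrees are at least `2`, then two vertices `a` and `b` of degree `2` are adjacent. A
  connected set that contains `a` but not `b` is `{a}` or contains the other neighbour of `a`, so
  there are about `2 ^ (n - 3)` of these, and likewise with `a` and `b` exchanged.

Induction from the trivial bound `27` for `n = 5` gives `N(G) ≤ 2 ^ (n - 1) + max 11 (n + 2)` for
all connected graphs with `n ≥ 5` vertices and at most `n + 1` edges
(`SimpleGraph.numConnectedSets_le_add_max`), and one more contraction gives the claim for `n ≥ 8`.
-/

open SimpleGraph

/-! ### Connected sets -/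

/-- A connected set that meets both `T` and its complement contains an edge across `T`. -/
theorem SimpleGraph.exists_adj_of_connected_induce {V : Type*} {G : SimpleGraph V} {S T : Set V}
    (h : (G.induce S).Connected) {x y : V} (hx : x ∈ S) (hxT : x ∈ T) (hy : y ∈ S) (hyT : y ∉ T) :
    ∃ p ∈ S, ∃ q ∈ S, p ∈ T ∧ q ∉ T ∧ G.Adj p q := by
  obtain ⟨w⟩ := h.preconnected ⟨x, hx⟩ ⟨y, hy⟩
  obtain ⟨d, -, h1, h2⟩ := w.exists_boundary_dart (Subtype.val ⁻¹' T) hxT hyT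
  exact ⟨d.fst, d.fst.2, d.snd, d.snd.2, h1, h2, d.adj⟩

/-- In a connected set with at least two elements every element has a neighbour. -/
theorem SimpleGraph.exists_adj_mem_of_connected_induce {V : Type*} {G : SimpleGraph V} {S : Set V}
    (h : (G.induce S).Connected) {x y : V} (hx : x ∈ S) (hy : y ∈ S) (hxy : x ≠ y) :
    ∃ q ∈ S, G.Adj x q := by
  obtain ⟨p, -, q, hq, rfl, -, hpq⟩ :=
    exists_adj_of_connected_induce (T := {x}) h hx rfl hy (fun h => hxy h.symm)
  exact ⟨q, hq, hpq⟩

theorem SimpleGraph.connected_induce_singleton {V : Type*} (G : SimpleGraph V) (v : V) :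
    (G.induce {v}).Connected := by
  have : Nonempty ({v} : Set V) := ⟨⟨v, rfl⟩⟩
  have : Subsingleton ({v} : Set V) := by simp
  exact ⟨Preconnected.of_subsingleton⟩

/-- The image of a connected set is connected, for a map that sends each edge to an edge or to a
single vertex. -/
theorem SimpleGraph.connected_induce_image {V W : Type*} {G : SimpleGraph V} {H : SimpleGraph W}
    {f : V → W} (hf : ∀ x y, G.Adj x y → f x = f y ∨ H.Adj (f x) (f y)) {S : Set V}
    (h : (G.induce S).Connected) : (H.induce (f '' S)).Connected := by
  have key : ∀ (x y : S), (G.induce S).Walk x y →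
      (H.induce (f '' S)).Reachable ⟨f x, x, x.2, rfl⟩ ⟨f y, y, y.2, rfl⟩ := by
    intro x y w
    induction w with
    | nil => rfl
    | @cons x z y hxz _ ih =>
      refine Reachable.trans ?_ ih
      rcases hf _ _ hxz with h | h
      · have : (⟨f x, x, x.2, rfl⟩ : f '' S) = ⟨f z, z, z.2, rfl⟩ := Subtype.ext h
        rw [this]
      · exact Adj.reachable (by exact h)
  obtain ⟨s⟩ := h.nonempty
  refine (connected_iff _).2 ⟨?_, ⟨⟨f s, s, s.2, rfl⟩⟩⟩
  rintro ⟨_, x, hx, rfl⟩ ⟨_, y, hy, rfl⟩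
  obtain ⟨w⟩ := h.preconnected ⟨x, hx⟩ ⟨y, hy⟩
  exact key _ _ w

theorem SimpleGraph.Iso.numConnectedSets_le {V W : Type*} [Finite W] {G : SimpleGraph V}
    {H : SimpleGraph W} (e : G ≃g H) : G.numConnectedSets ≤ H.numConnectedSets :=
  Set.ncard_le_ncard_of_injOn (fun S => e '' S)
    (fun _ hS => connected_induce_image (fun _ _ h => Or.inr (e.map_rel_iff.2 h)) hS)
    (fun _ _ _ _ h => e.injective.image_injective h)

/-! ### Contraction of an edge -/

/-- The connected sets of `G` that contain `a` but not `b`. -/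
def SimpleGraph.connectedSetsSep {V : Type*} (G : SimpleGraph V) (a b : V) : Set (Set V) :=
  {S | (G.induce S).Connected ∧ a ∈ S ∧ b ∉ S}

/-- The connected sets that contain both or neither of `a` and `b` are mapped injectively to
connected sets when `a` and `b` are identified. -/
theorem SimpleGraph.numConnectedSets_le_map {V W : Type*} [Finite V] [Finite W]
    (G : SimpleGraph V) (f : V → W) (a b : V)
    (hf : ∀ x y, f x = f y → x = y ∨ (x = a ∧ y = b) ∨ (x = b ∧ y = a)) :
    G.numConnectedSets ≤ (G.map f).numConnectedSets +
      ((G.connectedSetsSep a b).ncard + (G.connectedSetsSep b a).ncard) := by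
  have h1 : {S : Set V | (G.induce S).Connected} ⊆
      {S : Set V | (G.induce S).Connected ∧ (a ∈ S ↔ b ∈ S)} ∪
        (G.connectedSetsSep a b ∪ G.connectedSetsSep b a) := by
    intro S hS
    simp only [connectedSetsSep, Set.mem_union, Set.mem_ofPred_eq] at hS ⊢
    tauto
  have h2 : {S : Set V | (G.induce S).Connected ∧ (a ∈ S ↔ b ∈ S)}.ncard ≤
      (G.map f).numConnectedSets := by
    refine Set.ncard_le_ncard_of_injOn (fun S => f '' S) ?_ ?_
    · intro S hS
      refine connected_induce_image (fun x y h => ?_) hS.1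
      by_cases hxy : f x = f y
      · exact Or.inl hxy
      · exact Or.inr ⟨hxy, x, y, h, rfl, rfl⟩
    · have aux : ∀ S : Set V, (a ∈ S ↔ b ∈ S) → f ⁻¹' (f '' S) = S := by
        intro S hS
        ext x
        constructor
        · rintro ⟨y, hy, hyx⟩
          rcases hf _ _ hyx with rfl | ⟨rfl, rfl⟩ | ⟨rfl, rfl⟩
          exacts [hy, hS.1 hy, hS.2 hy]
        · exact fun hx => ⟨x, hx, rfl⟩
      intro S hS T hT hST
      rw [← aux S hS.2, ← aux T hT.2]
      exact congrArg _ hST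
  calc G.numConnectedSets ≤ _ := Set.ncard_le_ncard h1
    _ ≤ _ := Set.ncard_union_le _ _
    _ ≤ _ := Nat.add_le_add h2 (Set.ncard_union_le _ _)

theorem SimpleGraph.ncard_edgeSet_map_lt {V W : Type*} [Finite V] {G : SimpleGraph V} {f : V → W}
    {a b : V} (hab : G.Adj a b) (hf : f a = f b) :
    (G.map f).edgeSet.ncard < G.edgeSet.ncard := by
  have h1 : (G.map f).edgeSet ⊆ Sym2.map f '' (G.edgeSet \ {s(a, b)}) := by
    intro e
    induction e with
    | _ p q =>
      rintro ⟨hne, x, y, hxy, rfl, rfl⟩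
      refine ⟨s(x, y), ⟨hxy, ?_⟩, rfl⟩
      intro h
      rcases Sym2.eq_iff.1 h with ⟨rfl, rfl⟩ | ⟨rfl, rfl⟩
      exacts [hne hf, hne hf.symm]
  calc _ ≤ _ := Set.ncard_le_ncard h1
    _ ≤ _ := Set.ncard_image_le
    _ < _ := Set.ncard_sdiff_singleton_lt_of_mem hab

/-- Contracting the edge `ab`: an upper bound for the number of connected sets, through a connected
graph with one vertex less and at least one edge less. -/
theorem SimpleGraph.exists_contraction {V : Type*} [Finite V] {G : SimpleGraph V}
    (hG : G.Connected) {a b : V} (hab : G.Adj a b) :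
    ∃ H : SimpleGraph {v : V // v ≠ b}, H.Connected ∧ H.edgeSet.ncard < G.edgeSet.ncard ∧
      G.numConnectedSets ≤ H.numConnectedSets +
        ((G.connectedSetsSep a b).ncard + (G.connectedSetsSep b a).ncard) := by
  classical
  let f : V → {v : V // v ≠ b} := fun v => if h : v = b then ⟨a, hab.ne⟩ else ⟨v, h⟩
  have hfb : f b = ⟨a, hab.ne⟩ := by simp [f]
  have hfo : ∀ v (h : v ≠ b), f v = ⟨v, h⟩ := fun v h => by simp [f, h]
  refine ⟨G.map f, ?_, ncard_edgeSet_map_lt hab (by rw [hfb, hfo _ hab.ne]),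
    G.numConnectedSets_le_map f a b ?_⟩
  · have h := connected_induce_image (H := G.map f) (f := f) (S := Set.univ) (fun x y h => by
      by_cases hxy : f x = f y
      · exact Or.inl hxy
      · exact Or.inr ⟨hxy, x, y, h, rfl, rfl⟩) (induceUnivIso G |>.connected_iff.2 hG)
    have hs : f '' Set.univ = Set.univ := by
      rw [Set.image_univ, Set.range_eq_univ]
      exact fun v => ⟨v, hfo _ v.2⟩
    rw [hs] at h
    exact (induceUnivIso _).connected_iff.1 h
  · intro x y hxy
    by_cases hx : x = b <;> by_cases hy : y = b
    · exact Or.inl (hx.trans hy.symm)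
    · subst hx; rw [hfb, hfo y hy, Subtype.mk.injEq] at hxy; tauto
    · subst hy; rw [hfb, hfo x hx, Subtype.mk.injEq] at hxy; tauto
    · rw [hfo x hx, hfo y hy, Subtype.mk.injEq] at hxy; exact Or.inl hxy

/-! ### Counting sets with prescribed elements -/

/-- The sets that contain `A` and avoid `B` correspond to the subsets of the complement of
`A ∪ B`. -/
theorem ncard_setOf_subset_disjoint {V : Type*} [Finite V] {A B : Set V} (h : Disjoint A B) :
    {S : Set V | A ⊆ S ∧ Disjoint B S}.ncard = 2 ^ (Nat.card V - (A ∪ B).ncard) := by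
  rw [← Set.ncard_compl, ← Set.ncard_powerset]
  refine (Set.ncard_congr (fun S _ => S ∪ A) ?_ ?_ ?_).symm
  · intro S hS
    refine ⟨Set.subset_union_right, ?_⟩
    rw [Set.disjoint_union_right]
    refine ⟨?_, h.symm⟩
    rw [Set.disjoint_left]
    exact fun x hx hxS => hS hxS (Or.inr hx)
  · intro S T hS hT hST
    have aux : ∀ S ∈ 𝒫 (A ∪ B)ᶜ, (S ∪ A) \ A = S := by
      intro S hS
      rw [Set.union_sdiff_right, sdiff_eq_left, Set.disjoint_left]
      exact fun x hx hxA => hS hx (Or.inl hxA)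
    rw [← aux S hS, ← aux T hT]
    exact congrArg (· \ A) hST
  · rintro S ⟨hA, hB⟩
    refine ⟨S \ A, ?_, Set.sdiff_union_of_subset hA⟩
    rintro x ⟨hx, hxA⟩ (h | h)
    exacts [hxA h, Set.disjoint_left.1 hB h hx]

theorem ncard_setOf_mem {V : Type*} [Finite V] (u : V) :
    {S : Set V | u ∈ S}.ncard = 2 ^ (Nat.card V - 1) := by
  have h := ncard_setOf_subset_disjoint (V := V) (A := {u}) (B := ∅) (by simp)
  simpa using h

theorem ncard_setOf_mem_notMem {V : Type*} [Finite V] {u v : V} (huv : u ≠ v) :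
    {S : Set V | u ∈ S ∧ v ∉ S}.ncard = 2 ^ (Nat.card V - 2) := by
  have h := ncard_setOf_subset_disjoint (V := V) (A := {u}) (B := {v}) (by simpa using huv)
  rw [Set.singleton_union, Set.ncard_pair huv] at h
  simpa using h

theorem ncard_setOf_mem_mem_notMem {V : Type*} [Finite V] {a x b : V} (hax : a ≠ x) (hab : a ≠ b)
    (hxb : x ≠ b) : {S : Set V | (a ∈ S ∧ x ∈ S) ∧ b ∉ S}.ncard = 2 ^ (Nat.card V - 3) := by
  have h := ncard_setOf_subset_disjoint (V := V) (A := {a, x}) (B := {b})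
    (by simp [hab.symm, hxb.symm])
  have h3 : (({a, x} : Set V) ∪ {b}).ncard = 3 := by
    rw [Set.insert_union, Set.singleton_union]
    exact Set.ncard_eq_three.2 ⟨a, x, b, hax, hab, hxb, rfl⟩
  rw [h3] at h
  simpa [Set.insert_subset_iff] using h

/-! ### Edges separated by few connected sets -/

theorem SimpleGraph.ncard_neighborSet {V : Type*} [Fintype V] (G : SimpleGraph V)
    [DecidableRel G.Adj] (v : V) : (G.neighborSet v).ncard = G.degree v := by
  rw [Set.ncard_eq_toFinset_card', Set.toFinset_card, card_neighborSet_eq_degree]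

/-- If `v` is a leaf at `u`, then of the sets that contain `u` but not `v` the following are
disconnected: `{u, z}` for every non-neighbour `z` of `u`, and, for one such non-neighbour `x`,
`{u, x, y}` for every non-neighbour `y` of `x`. -/
theorem SimpleGraph.ncard_connectedSetsSep_leaf {V : Type*} [Finite V] {G : SimpleGraph V}
    {v u x : V} (hv : G.neighborSet v = {u}) (hux : u ≠ x) (hx : ¬ G.Adj u x) :
    (G.connectedSetsSep u v).ncard + 2 * Nat.card V ≤
      2 ^ (Nat.card V - 2) + ((G.neighborSet u).ncard + (G.neighborSet x).ncard) + 4 := by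
  have hvu : G.Adj v u := by
    have : u ∈ G.neighborSet v := by rw [hv]; rfl
    exact this
  have hvx : v ≠ x := by rintro rfl; exact hx hvu.symm
  set Z₁ : Set V := {z | z ≠ u ∧ ¬ G.Adj u z} with hZ₁
  set Z₂ : Set V := {y | y ≠ u ∧ y ≠ x ∧ y ≠ v ∧ ¬ G.Adj x y} with hZ₂
  have c₁ : Nat.card V ≤ Z₁.ncard + ((G.neighborSet u).ncard + 1) := by
    rw [← Set.ncard_add_ncard_compl Z₁]
    gcongr
    refine (Set.ncard_le_ncard (t := insert u (G.neighborSet u)) ?_).trans (Set.ncard_insert_le _ _)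
    intro z hz
    simp only [hZ₁, Set.mem_compl_iff, Set.mem_ofPred_eq, Set.mem_insert_iff,
      mem_neighborSet] at hz ⊢
    tauto
  have c₂ : Nat.card V ≤ Z₂.ncard + ((G.neighborSet x).ncard + 1 + 1 + 1) := by
    rw [← Set.ncard_add_ncard_compl Z₂]
    gcongr
    refine (Set.ncard_le_ncard (t := insert u (insert x (insert v (G.neighborSet x)))) ?_).trans
      ((Set.ncard_insert_le _ _).trans (Nat.succ_le_succ ((Set.ncard_insert_le _ _).trans
        (Nat.succ_le_succ (Set.ncard_insert_le _ _)))))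
    intro z hz
    simp only [hZ₂, Set.mem_compl_iff, Set.mem_ofPred_eq, Set.mem_insert_iff,
      mem_neighborSet] at hz ⊢
    tauto
  have i₁ : ((fun z => ({u, z} : Set V)) '' Z₁).ncard = Z₁.ncard := by
    refine Set.InjOn.ncard_image ?_
    intro z hz z' hz' h
    have : z ∈ ({u, z'} : Set V) := by rw [← show ({u, z} : Set V) = {u, z'} from h]; simp
    exact this.resolve_left hz.1
  have i₂ : ((fun y => ({u, x, y} : Set V)) '' Z₂).ncard = Z₂.ncard := by
    refine Set.InjOn.ncard_image ?_
    intro y hy y' hy' h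
    have : y ∈ ({u, x, y'} : Set V) := by
      rw [← show ({u, x, y} : Set V) = {u, x, y'} from h]; simp
    exact (this.resolve_left hy.1).resolve_left hy.2.1
  have d : Disjoint ((fun z => ({u, z} : Set V)) '' Z₁) ((fun y => ({u, x, y} : Set V)) '' Z₂) := by
    rw [Set.disjoint_left]
    rintro _ ⟨z, hz, rfl⟩ ⟨y, hy, h⟩
    replace h : ({u, x, y} : Set V) = {u, z} := h
    have h1 : x ∈ ({u, z} : Set V) := by rw [← h]; simp
    have h2 : y ∈ ({u, z} : Set V) := by rw [← h]; simp
    exact hy.2.1 ((h2.resolve_left hy.1).trans (h1.resolve_left hux.symm).symm)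
  have d' : Disjoint (G.connectedSetsSep u v)
      ((fun z => ({u, z} : Set V)) '' Z₁ ∪ (fun y => ({u, x, y} : Set V)) '' Z₂) := by
    rw [Set.disjoint_left]
    rintro S ⟨hS, -, -⟩ (⟨z, hz, rfl⟩ | ⟨y, hy, rfl⟩)
    · obtain ⟨q, hq, h⟩ := exists_adj_mem_of_connected_induce hS (x := u) (y := z)
        (by simp) (by simp) hz.1.symm
      rcases hq with rfl | rfl
      exacts [h.ne rfl, hz.2 h]
    · obtain ⟨q, hq, h⟩ := exists_adj_mem_of_connected_induce hS (x := x) (y := u)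
        (by simp) (by simp) hux.symm
      rcases hq with rfl | rfl | rfl
      exacts [hx h.symm, h.ne rfl, hy.2.2.2 h]
  have hsub : G.connectedSetsSep u v ∪
      ((fun z => ({u, z} : Set V)) '' Z₁ ∪ (fun y => ({u, x, y} : Set V)) '' Z₂) ⊆
      {S : Set V | u ∈ S ∧ v ∉ S} := by
    rintro S (⟨-, h⟩ | ⟨z, hz, rfl⟩ | ⟨y, hy, rfl⟩)
    · exact h
    · refine ⟨by simp, ?_⟩
      rintro (rfl | rfl)
      exacts [hvu.ne rfl, hz.2 hvu.symm]
    · refine ⟨by simp, ?_⟩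
      rintro (rfl | rfl | rfl)
      exacts [hvu.ne rfl, hvx rfl, hy.2.2.1 rfl]
  have := Set.ncard_le_ncard hsub
  rw [Set.ncard_union_eq d', Set.ncard_union_eq d, i₁, i₂,
    ncard_setOf_mem_notMem hvu.ne.symm] at this
  omega

theorem SimpleGraph.ncard_connectedSetsSep_leaf_le_one {V : Type*} {G : SimpleGraph V}
    {v u : V} (hv : G.neighborSet v = {u}) : (G.connectedSetsSep v u).ncard ≤ 1 := by
  have h : G.connectedSetsSep v u ⊆ {{v}} := by
    rintro S ⟨hS, hvS, huS⟩
    refine Set.eq_singleton_iff_unique_mem.2 ⟨hvS, fun y hy => ?_⟩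
    by_contra hne
    obtain ⟨q, hq, h⟩ := exists_adj_mem_of_connected_induce hS hvS hy (Ne.symm hne)
    have : q ∈ G.neighborSet v := h
    rw [hv] at this
    exact huS (this ▸ hq)
  exact (Set.ncard_le_ncard h).trans (Set.ncard_singleton _).le

/-- If the neighbours of `a` are `b` and `x`, then a connected set that contains `a` but not `b` is
`{a}` or contains `x`, and it is none of the sets `{a, x, z}` with `z` not adjacent to `x`. -/
theorem SimpleGraph.ncard_connectedSetsSep_of_neighborSet_eq_pair {V : Type*} [Finite V]
    {G : SimpleGraph V} {a b x : V} (ha : G.neighborSet a = {b, x}) (hxb : x ≠ b) :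
    (G.connectedSetsSep a b).ncard + Nat.card V ≤
      2 ^ (Nat.card V - 3) + (G.neighborSet x \ {a, b}).ncard + 4 := by
  have hadj : ∀ w, G.Adj a w ↔ w = b ∨ w = x := fun w => by
    rw [← mem_neighborSet, ha]; rfl
  have hax : a ≠ x := ((hadj x).2 (Or.inr rfl)).ne
  have hab : a ≠ b := ((hadj b).2 (Or.inl rfl)).ne
  set Z : Set V := {z | z ≠ a ∧ z ≠ b ∧ z ≠ x ∧ ¬ G.Adj x z} with hZ
  have c : Nat.card V ≤ Z.ncard + ((G.neighborSet x \ {a, b}).ncard + 1 + 1 + 1) := by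
    rw [← Set.ncard_add_ncard_compl Z]
    gcongr
    refine (Set.ncard_le_ncard
      (t := insert a (insert b (insert x (G.neighborSet x \ {a, b})))) ?_).trans
      ((Set.ncard_insert_le _ _).trans (Nat.succ_le_succ ((Set.ncard_insert_le _ _).trans
        (Nat.succ_le_succ (Set.ncard_insert_le _ _)))))
    intro z hz
    simp only [hZ, Set.mem_compl_iff, Set.mem_ofPred_eq, Set.mem_insert_iff, Set.mem_sdiff,
      mem_neighborSet, Set.mem_singleton_iff] at hz ⊢
    tauto
  have i : ((fun z => ({a, x, z} : Set V)) '' Z).ncard = Z.ncard := by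
    refine Set.InjOn.ncard_image ?_
    intro y hy y' hy' h
    have : y ∈ ({a, x, y'} : Set V) := by
      rw [← show ({a, x, y} : Set V) = {a, x, y'} from h]; simp
    exact (this.resolve_left hy.1).resolve_left hy.2.2.1
  have d : Disjoint (G.connectedSetsSep a b) ((fun z => ({a, x, z} : Set V)) '' Z) := by
    rw [Set.disjoint_left]
    rintro S ⟨hS, -, -⟩ ⟨z, hz, rfl⟩
    obtain ⟨q, hq, h⟩ := exists_adj_mem_of_connected_induce hS (x := z) (y := a)
      (by simp) (by simp) hz.1
    rcases hq with rfl | rfl | rfl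
    · rcases (hadj z).1 h.symm with h | h
      exacts [hz.2.1 h, hz.2.2.1 h]
    · exact hz.2.2.2 h.symm
    · exact h.ne rfl
  have hsub : G.connectedSetsSep a b ∪ (fun z => ({a, x, z} : Set V)) '' Z ⊆
      insert {a} {S : Set V | (a ∈ S ∧ x ∈ S) ∧ b ∉ S} := by
    rintro S (⟨hS, haS, hbS⟩ | ⟨z, hz, rfl⟩)
    · by_cases hSa : S = {a}
      · exact Or.inl hSa
      refine Or.inr ⟨⟨haS, ?_⟩, hbS⟩
      obtain ⟨y, hy, hya⟩ : ∃ y ∈ S, y ≠ a := by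
        by_contra! hne
        exact hSa (Set.eq_singleton_iff_unique_mem.2 ⟨haS, hne⟩)
      obtain ⟨q, hq, h⟩ := exists_adj_mem_of_connected_induce hS haS hy hya.symm
      rcases (hadj q).1 h with rfl | rfl
      exacts [(hbS hq).elim, hq]
    · refine Or.inr ⟨by simp, ?_⟩
      rintro (rfl | rfl | rfl)
      exacts [hab rfl, hxb rfl, hz.2.1 rfl]
  have := (Set.ncard_le_ncard hsub).trans (Set.ncard_insert_le _ _)
  rw [Set.ncard_union_eq d, i, ncard_setOf_mem_mem_notMem hax hab hxb] at this
  omega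

/-- No edge is incident with two vertices of an independent set. -/
theorem SimpleGraph.sum_degree_le_card_edgeFinset {V : Type*} [Fintype V] [DecidableEq V]
    (G : SimpleGraph V) [DecidableRel G.Adj] (D : Finset V)
    (hD : ∀ a ∈ D, ∀ b ∈ D, a ≠ b → ¬ G.Adj a b) :
    ∑ a ∈ D, G.degree a ≤ G.edgeFinset.card := by
  simp_rw [← card_incidenceFinset_eq_degree]
  rw [← Finset.card_biUnion]
  · refine Finset.card_le_card fun e he => ?_
    obtain ⟨a, -, h⟩ := Finset.mem_biUnion.1 he
    exact G.incidenceFinset_subset a h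
  · intro a ha b hb hab
    rw [Function.onFun, Finset.disjoint_left]
    intro e hea heb
    have : e ∈ G.incidenceSet a ∩ G.incidenceSet b :=
      ⟨(G.mem_incidenceFinset a e).1 hea, (G.mem_incidenceFinset b e).1 heb⟩
    rw [G.incidenceSet_inter_incidenceSet_of_not_adj (hD a ha b hb hab) hab] at this
    exact this

/-- In a graph of minimum degree `2` with at most one more edge than vertices, at most two vertices
have larger degree; so if the vertices of degree `2` were independent there would be too many
edges. -/
theorem SimpleGraph.exists_adj_degree_eq_two {V : Type*} [Fintype V] [DecidableEq V]
    (G : SimpleGraph V) [DecidableRel G.Adj] (hn : 6 ≤ Fintype.card V)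
    (hE : G.edgeFinset.card ≤ Fintype.card V + 1) (hd : ∀ v, 2 ≤ G.degree v)
    (hs : ∑ v, (G.degree v - 2) ≤ 2) :
    ∃ a b, G.Adj a b ∧ G.degree a = 2 ∧ G.degree b = 2 := by
  by_contra! h
  obtain ⟨D, hD⟩ : ∃ D : Finset V, ∀ v, v ∈ D ↔ G.degree v = 2 :=
    ⟨Finset.univ.filter fun v => G.degree v = 2, by simp⟩
  have h1 := G.sum_degree_le_card_edgeFinset D (fun a ha b hb _ hab =>
    h a b hab ((hD a).1 ha) ((hD b).1 hb))
  rw [Finset.sum_congr rfl (fun a ha => ((hD a).1 ha)), Finset.sum_const,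
    smul_eq_mul] at h1
  have h2 : Dᶜ.card ≤ ∑ v, (G.degree v - 2) := by
    rw [Finset.card_eq_sum_ones]
    refine (Finset.sum_le_sum fun v hv => ?_).trans
      (Finset.sum_le_sum_of_subset (Finset.subset_univ Dᶜ))
    have hv2 : G.degree v ≠ 2 := fun h => Finset.mem_compl.1 hv ((hD v).2 h)
    have := hd v
    omega
  have h3 := D.card_add_card_compl
  omega

/-- A connected graph on `n ≥ 6` vertices with at most `n + 1` edges and no dominating vertex has an
edge `ab` that few connected sets separate: an edge at a leaf, or else an edge between two vertices
of degree `2`. -/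
theorem SimpleGraph.exists_adj_ncard_connectedSetsSep_le {V : Type*} [Finite V]
    {G : SimpleGraph V} (hG : G.Connected) (hn : 6 ≤ Nat.card V)
    (hE : G.edgeSet.ncard ≤ Nat.card V + 1) (hdom : ∀ u, ∃ x, u ≠ x ∧ ¬ G.Adj u x) :
    ∃ a b, G.Adj a b ∧ (G.connectedSetsSep a b).ncard + (G.connectedSetsSep b a).ncard +
      (Nat.card V - 6) ≤ 2 ^ (Nat.card V - 2) := by
  classical
  have := Fintype.ofFinite V
  rw [Set.ncard_eq_toFinset_card', ← edgeFinset] at hE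
  by_cases h1 : ∃ v, G.degree v = 1
  · obtain ⟨v, hv⟩ := h1
    rw [← ncard_neighborSet, Set.ncard_eq_one] at hv
    obtain ⟨u, hv⟩ := hv
    have hvu : G.Adj v u := by
      have : u ∈ G.neighborSet v := by rw [hv]; rfl
      exact this
    obtain ⟨x, hux, hx⟩ := hdom u
    have e1 := ncard_connectedSetsSep_leaf hv hux hx
    have e2 := ncard_connectedSetsSep_leaf_le_one hv
    -- As `u` and `x` are not adjacent, their degrees add up to at most `|E|`.
    have e3 := G.sum_degree_le_card_edgeFinset {u, x} (by
      intro a ha b hb hab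
      simp only [Finset.mem_insert, Finset.mem_singleton] at ha hb
      rcases ha with rfl | rfl <;> rcases hb with rfl | rfl
      exacts [(hab rfl).elim, hx, fun h => hx h.symm, (hab rfl).elim])
    rw [Finset.sum_pair hux, ← ncard_neighborSet, ← ncard_neighborSet] at e3
    refine ⟨v, u, hvu, ?_⟩
    omega
  · push Not at h1
    have hd : ∀ v, 2 ≤ G.degree v := fun v => by
      have : Nontrivial V := by
        rw [← Finite.one_lt_card_iff_nontrivial]; omega
      have := hG.preconnected.degree_pos_of_nontrivial v
      have := h1 v
      omega
    -- The handshake lemma: the degrees exceed `2` by a total of at most `2`.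
    have hs : ∑ v, (G.degree v - 2) ≤ 2 := by
      have e1 := G.sum_degrees_eq_twice_card_edges
      have e2 : ∑ v, G.degree v = ∑ v, (G.degree v - 2) + ∑ v : V, 2 := by
        rw [← Finset.sum_add_distrib]
        exact Finset.sum_congr rfl fun v _ => (Nat.sub_add_cancel (hd v)).symm
      rw [Finset.sum_const, smul_eq_mul, Finset.card_univ, ← Nat.card_eq_fintype_card] at e2
      omega
    obtain ⟨a, b, hab, ha, hb⟩ := G.exists_adj_degree_eq_two
      (by rwa [← Nat.card_eq_fintype_card]) (by rwa [← Nat.card_eq_fintype_card]) hd hs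
    have other : ∀ a b, G.Adj a b → G.degree a = 2 →
        ∃ x, x ≠ b ∧ G.neighborSet a = {b, x} := by
      intro a b hab ha
      rw [← ncard_neighborSet, Set.ncard_eq_two] at ha
      obtain ⟨p, q, hpq, h⟩ := ha
      have hb : b ∈ G.neighborSet a := hab
      rw [h] at hb
      rcases hb with rfl | rfl
      · exact ⟨q, hpq.symm, h⟩
      · exact ⟨p, hpq, by rw [h, Set.pair_comm]⟩
    obtain ⟨x, hxb, hNa⟩ := other a b hab ha
    obtain ⟨y, hya, hNb⟩ := other b a hab.symm hb
    have e1 := ncard_connectedSetsSep_of_neighborSet_eq_pair hNa hxb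
    have e2 := ncard_connectedSetsSep_of_neighborSet_eq_pair hNb hya
    have hax : a ∈ G.neighborSet x := by
      have : x ∈ G.neighborSet a := by rw [hNa]; simp
      exact (G.mem_neighborSet _ _).2 (Adj.symm this)
    have hby : b ∈ G.neighborSet y := by
      have : y ∈ G.neighborSet b := by rw [hNb]; simp
      exact (G.mem_neighborSet _ _).2 (Adj.symm this)
    -- If `x = y`, then both `a` and `b` are neighbours of `x`, which has degree at most `4`;
    -- otherwise the degrees of `x` and `y` add up to at most `6`.
    have e3 : (G.neighborSet x \ {a, b}).ncard + (G.neighborSet y \ {b, a}).ncard ≤ 4 := by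
      by_cases hxy : x = y
      · subst hxy
        have h1 : G.degree x - 2 ≤ 2 := (Finset.single_le_sum
          (fun v _ => Nat.zero_le (G.degree v - 2)) (Finset.mem_univ x)).trans hs
        have h2 : (G.neighborSet x \ {a, b}).ncard = G.degree x - 2 := by
          rw [Set.ncard_sdiff (by rintro _ (rfl | rfl) <;> assumption), Set.ncard_pair hab.ne,
            ncard_neighborSet]
        rw [Set.pair_comm b a, h2]
        omega
      · have h1 : G.degree x - 2 + (G.degree y - 2) ≤ 2 := by
          rw [← Finset.sum_pair (f := fun v => G.degree v - 2) hxy]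
          exact (Finset.sum_le_sum_of_subset (Finset.subset_univ _)).trans hs
        have h2 : (G.neighborSet x \ {a, b}).ncard ≤ G.degree x - 1 := by
          rw [← ncard_neighborSet, ← Set.ncard_sdiff_singleton_of_mem hax]
          exact Set.ncard_le_ncard (Set.sdiff_subset_sdiff_right (by simp))
        have h3 : (G.neighborSet y \ {b, a}).ncard ≤ G.degree y - 1 := by
          rw [← ncard_neighborSet, ← Set.ncard_sdiff_singleton_of_mem hby]
          exact Set.ncard_le_ncard (Set.sdiff_subset_sdiff_right (by simp))
        have := hd x
        have := hd y
        omega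
    have e4 : 2 ^ (Nat.card V - 2) = 2 * 2 ^ (Nat.card V - 3) := by
      rw [← pow_succ']
      congr 1
      omega
    exact ⟨a, b, hab, by omega⟩

/-! ### A crude upper bound -/

/-- The empty set and the pairs of non-adjacent vertices are not connected. -/
theorem SimpleGraph.numConnectedSets_add_choose_two_lt {V : Type*} [Finite V] (G : SimpleGraph V) :
    G.numConnectedSets + (Nat.card V).choose 2 < 2 ^ Nat.card V + G.edgeSet.ncard := by
  classical
  have := Fintype.ofFinite V
  have hE : (Nat.card V).choose 2 = Gᶜ.edgeSet.ncard + G.edgeSet.ncard := by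
    rw [Nat.card_eq_fintype_card, ← card_edgeFinset_top_eq_card_choose_two,
      ← Set.ncard_coe_finset, coe_edgeFinset, ← compl_sup_eq_top (x := G), edgeSet_sup,
      Set.ncard_union_eq]
    rw [disjoint_edgeSet]
    exact disjoint_compl_left
  have i : ((fun e : Sym2 V => (e : Set V)) '' Gᶜ.edgeSet).ncard = Gᶜ.edgeSet.ncard :=
    Set.ncard_image_of_injective _ SetLike.coe_injective
  have d : Disjoint {S : Set V | (G.induce S).Connected}
      (insert ∅ ((fun e : Sym2 V => (e : Set V)) '' Gᶜ.edgeSet)) := by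
    rw [Set.disjoint_left]
    rintro S hS (rfl | ⟨e, he, rfl⟩)
    · obtain ⟨x⟩ := Connected.nonempty hS
      exact x.2
    · induction e with
      | _ p q =>
        obtain ⟨hne, hpq⟩ := (compl_adj G p q).1 he
        replace hS : (G.induce (s(p, q) : Set V)).Connected := hS
        rw [Sym2.coe_mk] at hS
        obtain ⟨z, hz, h⟩ := exists_adj_mem_of_connected_induce hS (x := p) (y := q)
          (by simp) (by simp) hne
        rcases hz with rfl | rfl
        exacts [h.ne rfl, hpq h]
  have h0 : (∅ : Set V) ∉ (fun e : Sym2 V => (e : Set V)) '' Gᶜ.edgeSet := by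
    rintro ⟨e, -, he⟩
    induction e with
    | _ p q =>
      replace he : (s(p, q) : Set V) = ∅ := he
      rw [Sym2.coe_mk] at he
      exact (Set.insert_nonempty p {q}).ne_empty he
  have h := Set.ncard_le_ncard (Set.subset_univ ({S : Set V | (G.induce S).Connected} ∪
      (insert ∅ ((fun e : Sym2 V => (e : Set V)) '' Gᶜ.edgeSet))))
  rw [Set.ncard_union_eq d, Set.ncard_insert_of_notMem h0, i, ← Set.powerset_univ,
    Set.ncard_powerset, Set.ncard_univ] at h
  unfold numConnectedSets
  omega

/-! ### Graphs with a dominating vertex -/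

theorem SimpleGraph.connected_induce_of_forall_adj {V : Type*} {G : SimpleGraph V} {S : Set V}
    {u : V} (hu : u ∈ S) (h : ∀ v ∈ S, u ≠ v → G.Adj u v) : (G.induce S).Connected := by
  rw [connected_iff_exists_forall_reachable]
  refine ⟨⟨u, hu⟩, fun ⟨v, hv⟩ => ?_⟩
  by_cases huv : u = v
  · subst huv; rfl
  · exact Adj.reachable (h v hv huv)

/-- The edges of `G` that are not incident with `u`. -/
def SimpleGraph.edgesOff {V : Type*} (G : SimpleGraph V) (u : V) : Set (Sym2 V) :=
  {e ∈ G.edgeSet | u ∉ e}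

/-- A dominating vertex: one that is adjacent to all other vertices. -/
def SimpleGraph.IsDominatingVertex {V : Type*} (G : SimpleGraph V) (u : V) : Prop :=
  ∀ v, u ≠ v → G.Adj u v

theorem SimpleGraph.IsDominatingVertex.connected {V : Type*} {G : SimpleGraph V} {u : V}
    (hu : G.IsDominatingVertex u) : G.Connected :=
  (induceUnivIso G).connected_iff.1
    (connected_induce_of_forall_adj (Set.mem_univ u) fun v _ => hu v)

theorem SimpleGraph.IsDominatingVertex.ncard_edgeSet {V : Type*} [Finite V] {G : SimpleGraph V}
    {u : V} (hu : G.IsDominatingVertex u) :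
    G.edgeSet.ncard = (G.edgesOff u).ncard + (Nat.card V - 1) := by
  have h : G.edgeSet = G.edgesOff u ∪ (fun w => s(u, w)) '' {u}ᶜ := by
    ext e
    constructor
    · intro he
      by_cases hue : u ∈ e
      · obtain ⟨w, rfl⟩ := hue
        exact Or.inr ⟨w, (Adj.ne he).symm, rfl⟩
      · exact Or.inl ⟨he, hue⟩
    · rintro (he | ⟨w, hw, rfl⟩)
      · exact he.1
      · exact hu w (Ne.symm hw)
  rw [h, Set.ncard_union_eq, Set.ncard_image_of_injective, Set.ncard_compl, Set.ncard_singleton]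
  · exact fun x y hxy => Sym2.congr_right.1 hxy
  · rw [Set.disjoint_left]
    rintro _ he ⟨w, -, rfl⟩
    exact he.2 (Sym2.mem_mk_left u w)

/-- All sets that contain a dominating vertex are connected. -/
theorem SimpleGraph.IsDominatingVertex.numConnectedSets_eq {V : Type*} [Finite V]
    {G : SimpleGraph V} {u : V} (hu : G.IsDominatingVertex u) :
    G.numConnectedSets =
      2 ^ (Nat.card V - 1) + {S : Set V | (G.induce S).Connected ∧ u ∉ S}.ncard := by
  have h : {S : Set V | (G.induce S).Connected} =
      {S : Set V | u ∈ S} ∪ {S : Set V | (G.induce S).Connected ∧ u ∉ S} := by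
    ext S
    have : u ∈ S → (G.induce S).Connected :=
      fun h => connected_induce_of_forall_adj h fun v _ => hu v
    simp only [Set.mem_ofPred_eq, Set.mem_union]
    tauto
  rw [numConnectedSets, h, Set.ncard_union_eq, ncard_setOf_mem]
  rw [Set.disjoint_left]
  exact fun S hS hS' => hS'.2 hS

/-- A connected set that avoids `u` is a singleton or is covered by the edges it spans. -/
theorem SimpleGraph.eq_singleton_or_eq_setOf_mem_edge {V : Type*} {G : SimpleGraph V} {u : V}
    {S : Set V} (hS : (G.induce S).Connected) (hu : u ∉ S) :
    (∃ v ≠ u, S = {v}) ∨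
      ∃ F ⊆ G.edgesOff u, F.Nonempty ∧ S = {v | ∃ e ∈ F, v ∈ e} := by
  obtain ⟨x, hx⟩ := hS.nonempty
  by_cases h : S = {x}
  · exact Or.inl ⟨x, fun hxu => hu (hxu ▸ hx), h⟩
  have key : ∀ v ∈ S, ∃ e ∈ G.edgesOff u, (∀ w ∈ e, w ∈ S) ∧ v ∈ e := by
    intro v hv
    have hne : ∃ y ∈ S, v ≠ y := by
      by_contra! hne
      exact h (Set.eq_singleton_iff_unique_mem.2
        ⟨hx, fun y hy => (hne y hy).symm.trans (hne x hx)⟩)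
    obtain ⟨y, hy, hvy⟩ := hne
    obtain ⟨q, hq, hvq⟩ := exists_adj_mem_of_connected_induce hS hv hy hvy
    have hsub : ∀ w ∈ s(v, q), w ∈ S := by
      intro w hw
      rcases Sym2.mem_iff.1 hw with rfl | rfl <;> assumption
    exact ⟨s(v, q), ⟨hvq, fun hu' => hu (hsub u hu')⟩, hsub, Sym2.mem_mk_left v q⟩
  refine Or.inr ⟨{e ∈ G.edgesOff u | ∀ w ∈ e, w ∈ S}, fun e he => he.1, ?_, ?_⟩
  · obtain ⟨e, he, heS, -⟩ := key x hx
    exact ⟨e, he, heS⟩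
  · ext v
    constructor
    · intro hv
      obtain ⟨e, he, heS, hve⟩ := key v hv
      exact ⟨e, ⟨he, heS⟩, hve⟩
    · rintro ⟨e, ⟨-, heS⟩, hve⟩
      exact heS v hve

/-- Off the dominating vertex there are at most two edges, hence at most three nonempty sets of
edges whose union is a connected set, in addition to the `n - 1` singletons. -/
theorem SimpleGraph.IsDominatingVertex.numConnectedSets_le {V : Type*} [Finite V]
    {G : SimpleGraph V} {u : V} (hu : G.IsDominatingVertex u)
    (hE : G.edgeSet.ncard ≤ Nat.card V + 1) :
    G.numConnectedSets ≤ 2 ^ (Nat.card V - 1) + Nat.card V + 2 := by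
  have hV : 0 < Nat.card V := Nat.card_pos_iff.2 ⟨⟨u⟩, inferInstance⟩
  have hE' := hu.ncard_edgeSet
  have hsub : {S : Set V | (G.induce S).Connected ∧ u ∉ S} ⊆
      (fun v => ({v} : Set V)) '' {u}ᶜ ∪
        (fun F : Set (Sym2 V) => {v | ∃ e ∈ F, v ∈ e}) '' (𝒫 (G.edgesOff u) \ {∅}) := by
    rintro S ⟨hS, huS⟩
    rcases eq_singleton_or_eq_setOf_mem_edge hS huS with ⟨v, hv, rfl⟩ | ⟨F, hF, hne, rfl⟩
    · exact Or.inl ⟨v, hv, rfl⟩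
    · exact Or.inr ⟨F, ⟨hF, hne.ne_empty⟩, rfl⟩
  have h1 := (Set.ncard_le_ncard hsub).trans (Set.ncard_union_le _ _)
  have h2 : ((fun v => ({v} : Set V)) '' {u}ᶜ).ncard ≤ Nat.card V - 1 :=
    (Set.ncard_image_le (Set.toFinite _)).trans (by rw [Set.ncard_compl, Set.ncard_singleton])
  have h3 : ((fun F : Set (Sym2 V) => {v | ∃ e ∈ F, v ∈ e}) ''
      (𝒫 (G.edgesOff u) \ {∅})).ncard ≤ 2 ^ (G.edgesOff u).ncard - 1 :=
    (Set.ncard_image_le (Set.toFinite _)).trans (by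
      rw [Set.ncard_sdiff_singleton_of_mem (Set.empty_subset _), Set.ncard_powerset])
  have h4 : 2 ^ (G.edgesOff u).ncard ≤ 2 ^ 2 := Nat.pow_le_pow_right (by simp) (by omega)
  rw [hu.numConnectedSets_eq]
  omega

theorem ncard_image_singleton_compl {V : Type*} [Finite V] (u : V) :
    ((fun v => ({v} : Set V)) '' {u}ᶜ).ncard = Nat.card V - 1 := by
  rw [Set.ncard_image_of_injective _ Set.singleton_injective, Set.ncard_compl, Set.ncard_singleton]

theorem SimpleGraph.IsDominatingVertex.numConnectedSets_of_path {V : Type*} [Finite V]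
    {G : SimpleGraph V} {u p q r : V} (hu : G.IsDominatingVertex u) (hpr : p ≠ r)
    (hE : G.edgesOff u = {s(p, q), s(q, r)}) :
    G.numConnectedSets = 2 ^ (Nat.card V - 1) + Nat.card V + 2 := by
  have hV : 0 < Nat.card V := Nat.card_pos_iff.2 ⟨⟨u⟩, inferInstance⟩
  obtain ⟨hpq, hu1⟩ : s(p, q) ∈ G.edgesOff u := by rw [hE]; simp
  obtain ⟨hqr, hu2⟩ : s(q, r) ∈ G.edgesOff u := by rw [hE]; simp
  have hpq' : p ≠ q := Adj.ne hpq
  have hqr' : q ≠ r := Adj.ne hqr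
  simp only [Sym2.mem_iff, not_or] at hu1 hu2
  have h : {S : Set V | (G.induce S).Connected ∧ u ∉ S} =
      (fun v => ({v} : Set V)) '' {u}ᶜ ∪ {{p, q}, {q, r}, {p, q, r}} := by
    ext S
    constructor
    · rintro ⟨hS, huS⟩
      rcases eq_singleton_or_eq_setOf_mem_edge hS huS with ⟨v, hv, rfl⟩ | ⟨F, hF, hne, rfl⟩
      · exact Or.inl ⟨v, hv, rfl⟩
      · right
        rw [hE, Set.subset_pair_iff_eq] at hF
        rcases hF with rfl | rfl | rfl | rfl
        · simp at hne
        · left; ext v; simp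
        · right; left; ext v; simp
        · right; right; ext v; simp; tauto
    · rintro (⟨v, hv, rfl⟩ | rfl | rfl | rfl)
      · exact ⟨G.connected_induce_singleton v, fun h => hv h.symm⟩
      · exact ⟨induce_pair_connected_of_adj hpq, by simpa using hu1⟩
      · exact ⟨induce_pair_connected_of_adj hqr, by simpa using hu2⟩
      · refine ⟨connected_induce_of_forall_adj (u := q) (by simp) ?_, by simp; tauto⟩
        rintro v (rfl | rfl | rfl) hne
        exacts [Adj.symm hpq, (hne rfl).elim, hqr]
  have h3 : ({{p, q}, {q, r}, {p, q, r}} : Set (Set V)).ncard = 3 := by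
    refine Set.ncard_eq_three.2 ⟨_, _, _, ?_, ?_, ?_, rfl⟩
    · intro h
      have : p ∈ ({q, r} : Set V) := h ▸ by simp
      simp [hpq', hpr] at this
    · intro h
      have : r ∈ ({p, q} : Set V) := h ▸ by simp
      simp [hpr.symm, hqr'.symm] at this
    · intro h
      have : p ∈ ({q, r} : Set V) := h ▸ by simp
      simp [hpq', hpr] at this
  rw [hu.numConnectedSets_eq, h, Set.ncard_union_eq, ncard_image_singleton_compl, h3]
  · omega
  · rw [Set.disjoint_left]
    rintro _ ⟨v, -, rfl⟩ (h | h | h)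
    · exact hpq' (((Set.ext_iff.1 h p).2 (by simp)).trans ((Set.ext_iff.1 h q).2 (by simp)).symm)
    · exact hqr' (((Set.ext_iff.1 h q).2 (by simp)).trans ((Set.ext_iff.1 h r).2 (by simp)).symm)
    · exact hpq' (((Set.ext_iff.1 h p).2 (by simp)).trans ((Set.ext_iff.1 h q).2 (by simp)).symm)

theorem SimpleGraph.IsDominatingVertex.numConnectedSets_of_matching {V : Type*} [Finite V]
    {G : SimpleGraph V} {u p q r s : V} (hu : G.IsDominatingVertex u) (hpr : p ≠ r) (hps : p ≠ s)
    (hqr : q ≠ r) (hqs : q ≠ s) (hE : G.edgesOff u = {s(p, q), s(r, s)}) :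
    G.numConnectedSets = 2 ^ (Nat.card V - 1) + Nat.card V + 1 := by
  have hV : 0 < Nat.card V := Nat.card_pos_iff.2 ⟨⟨u⟩, inferInstance⟩
  obtain ⟨hpq, hu1⟩ : s(p, q) ∈ G.edgesOff u := by rw [hE]; simp
  obtain ⟨hrs, hu2⟩ : s(r, s) ∈ G.edgesOff u := by rw [hE]; simp
  have hpq' : p ≠ q := Adj.ne hpq
  have hrs' : r ≠ s := Adj.ne hrs
  simp only [Sym2.mem_iff, not_or] at hu1 hu2
  have h : {S : Set V | (G.induce S).Connected ∧ u ∉ S} =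
      (fun v => ({v} : Set V)) '' {u}ᶜ ∪ {{p, q}, {r, s}} := by
    ext S
    constructor
    · rintro ⟨hS, huS⟩
      rcases eq_singleton_or_eq_setOf_mem_edge hS huS with ⟨v, hv, rfl⟩ | ⟨F, hF, hne, hSF⟩
      · exact Or.inl ⟨v, hv, rfl⟩
      · right
        rw [hE, Set.subset_pair_iff_eq] at hF
        rcases hF with rfl | rfl | rfl | rfl
        · simp at hne
        · left; rw [hSF]; ext v; simp
        · right; rw [hSF]; ext v; simp
        · -- The union of the two edges is disconnected: no edge leaves `{p, q}` inside it.
          exfalso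
          have hp : p ∈ S := by rw [hSF]; simp
          have hr : r ∈ S := by rw [hSF]; simp
          obtain ⟨x, hx, y, hy, hxT, hyT, hxy⟩ :=
            exists_adj_of_connected_induce (T := {p, q}) hS hp (by simp) hr
              (by simp [hpr.symm, hqr.symm])
          have hE' : s(x, y) ∈ G.edgesOff u :=
            ⟨hxy, fun h => huS (by rcases Sym2.mem_iff.1 h with rfl | rfl <;> assumption)⟩
          rw [hE] at hE'
          simp only [Set.mem_insert_iff, Set.mem_singleton_iff, Sym2.eq_iff] at hE' hxT hyT
          grind
    · rintro (⟨v, hv, rfl⟩ | rfl | rfl)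
      · exact ⟨G.connected_induce_singleton v, fun h => hv h.symm⟩
      · exact ⟨induce_pair_connected_of_adj hpq, by simpa using hu1⟩
      · exact ⟨induce_pair_connected_of_adj hrs, by simpa using hu2⟩
  have h2 : ({{p, q}, {r, s}} : Set (Set V)).ncard = 2 := by
    refine Set.ncard_pair fun h => ?_
    have : p ∈ ({r, s} : Set V) := h ▸ by simp
    simp [hpr, hps] at this
  rw [hu.numConnectedSets_eq, h, Set.ncard_union_eq, ncard_image_singleton_compl, h2]
  · omega
  · rw [Set.disjoint_left]
    rintro _ ⟨v, -, rfl⟩ (h | h)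
    · exact hpq' (((Set.ext_iff.1 h p).2 (by simp)).trans ((Set.ext_iff.1 h q).2 (by simp)).symm)
    · exact hrs' (((Set.ext_iff.1 h r).2 (by simp)).trans ((Set.ext_iff.1 h s).2 (by simp)).symm)

/-! ### The graphs `bicyclicB n` and `bicyclicR n` -/

theorem isDominatingVertex_bicyclicB {n : ℕ} (hn : 0 < n) :
    (bicyclicB n).IsDominatingVertex ⟨0, hn⟩ :=
  fun _ hv => ⟨hv, Or.inl (Or.inl rfl)⟩

theorem isDominatingVertex_bicyclicR {n : ℕ} (hn : 0 < n) :
    (bicyclicR n).IsDominatingVertex ⟨0, hn⟩ :=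
  fun _ hv => ⟨hv, Or.inl (Or.inl rfl)⟩

theorem edgesOff_bicyclicB {n : ℕ} (hn : 4 ≤ n) :
    (bicyclicB n).edgesOff ⟨0, by omega⟩ =
      {s(⟨1, by omega⟩, ⟨2, by omega⟩), s(⟨2, by omega⟩, ⟨3, by omega⟩)} := by
  ext e
  induction e with
  | _ x y =>
    obtain ⟨x, hx⟩ := x
    obtain ⟨y, hy⟩ := y
    simp only [edgesOff, bicyclicB, Set.mem_sep_iff, mem_edgeSet, fromRel_adj, Sym2.mem_iff,
      Set.mem_insert_iff, Set.mem_singleton_iff, Sym2.eq_iff, Fin.mk.injEq, ne_eq]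
    omega

theorem edgesOff_bicyclicR {n : ℕ} (hn : 5 ≤ n) :
    (bicyclicR n).edgesOff ⟨0, by omega⟩ =
      {s(⟨1, by omega⟩, ⟨2, by omega⟩), s(⟨3, by omega⟩, ⟨4, by omega⟩)} := by
  ext e
  induction e with
  | _ x y =>
    obtain ⟨x, hx⟩ := x
    obtain ⟨y, hy⟩ := y
    simp only [edgesOff, bicyclicR, Set.mem_sep_iff, mem_edgeSet, fromRel_adj, Sym2.mem_iff,
      Set.mem_insert_iff, Set.mem_singleton_iff, Sym2.eq_iff, Fin.mk.injEq, ne_eq]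
    omega

theorem isBicyclic_bicyclicB {n : ℕ} (hn : 4 ≤ n) : (bicyclicB n).IsBicyclic := by
  have hu := isDominatingVertex_bicyclicB (n := n) (by omega)
  refine ⟨hu.connected, ?_⟩
  rw [hu.ncard_edgeSet, edgesOff_bicyclicB hn, Set.ncard_pair (by simp), Nat.card_fin]
  omega

theorem isBicyclic_bicyclicR {n : ℕ} (hn : 5 ≤ n) : (bicyclicR n).IsBicyclic := by
  have hu := isDominatingVertex_bicyclicR (n := n) (by omega)
  refine ⟨hu.connected, ?_⟩
  rw [hu.ncard_edgeSet, edgesOff_bicyclicR hn, Set.ncard_pair (by simp), Nat.card_fin]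
  omega

theorem numConnectedSets_bicyclicB {n : ℕ} (hn : 4 ≤ n) :
    (bicyclicB n).numConnectedSets = 2 ^ (n - 1) + n + 2 := by
  have hu := isDominatingVertex_bicyclicB (n := n) (by omega)
  simpa using hu.numConnectedSets_of_path (by simp) (edgesOff_bicyclicB hn)

theorem numConnectedSets_bicyclicR {n : ℕ} (hn : 5 ≤ n) :
    (bicyclicR n).numConnectedSets = 2 ^ (n - 1) + n + 1 := by
  have hu := isDominatingVertex_bicyclicR (n := n) (by omega)
  simpa using hu.numConnectedSets_of_matching (by simp) (by simp) (by simp) (by simp)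
    (edgesOff_bicyclicR hn)

/-- A graph with a dominating vertex whose removal leaves a path with two edges and isolated
vertices is isomorphic to `bicyclicB n`. -/
theorem SimpleGraph.IsDominatingVertex.nonempty_iso_bicyclicB {V : Type*} [Finite V]
    {G : SimpleGraph V} {u p q r : V} (hu : G.IsDominatingVertex u) (hpr : p ≠ r)
    (hE : G.edgesOff u = {s(p, q), s(q, r)}) {n : ℕ} (hn : 4 ≤ n) (hV : Nat.card V = n) :
    Nonempty (G ≃g bicyclicB n) := by
  classical
  have := Fintype.ofFinite V
  obtain ⟨hpq, hu1⟩ : s(p, q) ∈ G.edgesOff u := by rw [hE]; simp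
  obtain ⟨hqr, hu2⟩ : s(q, r) ∈ G.edgesOff u := by rw [hE]; simp
  have hpq' : p ≠ q := Adj.ne hpq
  have hqr' : q ≠ r := Adj.ne hqr
  simp only [Sym2.mem_iff, not_or] at hu1 hu2
  obtain ⟨hup, huq⟩ := hu1
  obtain ⟨-, hur⟩ := hu2
  obtain ⟨e, he0, he1, he2, he3⟩ : ∃ e : V ≃ Fin n,
      (e u).val = 0 ∧ (e p).val = 1 ∧ (e q).val = 2 ∧ (e r).val = 3 := by
    -- A prescribed injection on `{u, p, q, r}`, with junk values elsewhere, extends to a bijection.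
    let f : V → Fin n := fun v => if v = u then ⟨0, by omega⟩ else if v = p then ⟨1, by omega⟩
      else if v = q then ⟨2, by omega⟩ else ⟨3, by omega⟩
    have f0 : f u = ⟨0, by omega⟩ := by simp [f]
    have f1 : f p = ⟨1, by omega⟩ := by simp [f, Ne.symm hup]
    have f2 : f q = ⟨2, by omega⟩ := by simp [f, Ne.symm huq, hpq'.symm]
    have f3 : f r = ⟨3, by omega⟩ := by simp [f, Ne.symm hur, hpr.symm, hqr'.symm]
    have hf : Set.InjOn f {u, p, q, r} := by
      rintro x (rfl | rfl | rfl | rfl) y (rfl | rfl | rfl | rfl) h <;>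
        first | rfl | simp [f0, f1, f2, f3] at h
    obtain ⟨g, hg⟩ := Set.MapsTo.exists_equiv_extend_of_card_eq (t := Finset.univ)
      (by rw [← Nat.card_eq_fintype_card, hV, Finset.card_univ, Fintype.card_fin])
      (fun x _ => by simp) hf
    refine ⟨g.trans (Equiv.subtypeUnivEquiv fun x => Finset.mem_univ x), ?_⟩
    simp [hg, f0, f1, f2, f3]
  have hval : ∀ x y, (e x).val = (e y).val ↔ x = y := fun x y => by
    rw [Fin.val_inj, e.apply_eq_iff_eq]
  have h0 : ∀ x, (e x).val = 0 ↔ x = u := fun x => by rw [← he0, hval]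
  have h1 : ∀ x, (e x).val = 1 ↔ x = p := fun x => by rw [← he1, hval]
  have h2 : ∀ x, (e x).val = 2 ↔ x = q := fun x => by rw [← he2, hval]
  have h3 : ∀ x, (e x).val = 3 ↔ x = r := fun x => by rw [← he3, hval]
  refine ⟨⟨e, fun {x y} => ?_⟩⟩
  simp only [bicyclicB, fromRel_adj, h0, h1, h2, h3, ne_eq, e.apply_eq_iff_eq]
  by_cases hx : x = u
  · subst hx
    exact ⟨fun h => hu y h.1, fun h => ⟨h.ne, by tauto⟩⟩
  by_cases hy : y = u
  · subst hy
    exact ⟨fun h => (hu x (Ne.symm h.1)).symm, fun h => ⟨h.ne, by tauto⟩⟩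
  have hxy : G.Adj x y ↔ s(x, y) ∈ G.edgesOff u :=
    ⟨fun h => ⟨h, by simp [Ne.symm hx, Ne.symm hy]⟩, fun h => h.1⟩
  rw [hxy, hE]
  simp only [Set.mem_insert_iff, Set.mem_singleton_iff, Sym2.eq_iff]
  grind

/-- A bicyclic graph with a dominating vertex is `bicyclicB n`, or has as many connected sets as
`bicyclicR n`. -/
theorem SimpleGraph.IsDominatingVertex.nonempty_iso_or_numConnectedSets_eq {V : Type*} [Finite V]
    {G : SimpleGraph V} {u : V} (hu : G.IsDominatingVertex u) {n : ℕ} (hn : 4 ≤ n)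
    (hV : Nat.card V = n) (hE : G.edgeSet.ncard = n + 1) :
    Nonempty (G ≃g bicyclicB n) ∨ G.numConnectedSets = 2 ^ (n - 1) + n + 1 := by
  have h := hu.ncard_edgeSet
  have h2 : (G.edgesOff u).ncard = 2 := by omega
  obtain ⟨e, f, hef, hoff⟩ := Set.ncard_eq_two.1 h2
  induction e with
  | _ p q =>
    induction f with
    | _ r s =>
      by_cases hpr : p = r
      · subst hpr
        rw [Sym2.eq_swap] at hoff
        exact Or.inl (hu.nonempty_iso_bicyclicB (fun h => hef (by rw [h])) hoff hn hV)
      by_cases hps : p = s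
      · subst hps
        rw [Sym2.eq_swap, Sym2.eq_swap (a := r)] at hoff
        exact Or.inl (hu.nonempty_iso_bicyclicB (fun h => hef (by rw [h, Sym2.eq_swap])) hoff hn hV)
      by_cases hqr : q = r
      · subst hqr
        exact Or.inl (hu.nonempty_iso_bicyclicB hps hoff hn hV)
      by_cases hqs : q = s
      · subst hqs
        rw [Sym2.eq_swap (a := r)] at hoff
        exact Or.inl (hu.nonempty_iso_bicyclicB hpr hoff hn hV)
      right
      rw [← hV]
      exact hu.numConnectedSets_of_matching hpr hps hqr hqs hoff

/-! ### Graphs without a dominating vertex -/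

/-- The contraction step: without a dominating vertex, a contraction at a suitable edge loses few
connected sets. -/
theorem SimpleGraph.exists_contraction_of_not_isDominatingVertex {V : Type*} [Finite V]
    {G : SimpleGraph V} (hG : G.Connected) (hn : 6 ≤ Nat.card V)
    (hE : G.edgeSet.ncard ≤ Nat.card V + 1) (hdom : ∀ u, ¬ G.IsDominatingVertex u) :
    ∃ b, ∃ H : SimpleGraph {v : V // v ≠ b}, H.Connected ∧ H.edgeSet.ncard ≤ Nat.card V ∧
      G.numConnectedSets + (Nat.card V - 6) ≤ H.numConnectedSets + 2 ^ (Nat.card V - 2) := by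
  obtain ⟨a, b, hab, h⟩ := exists_adj_ncard_connectedSetsSep_le hG hn hE fun u => by
    simpa [IsDominatingVertex] using hdom u
  obtain ⟨H, hH, hHE, hGH⟩ := exists_contraction hG hab
  exact ⟨b, H, hH, by omega, by omega⟩

theorem Nat.card_subtype_ne {V : Type*} [Finite V] (b : V) :
    Nat.card {v : V // v ≠ b} = Nat.card V - 1 := by
  rw [← Set.ncard_singleton b, ← Set.ncard_compl]
  rfl

/-- A bound for all connected graphs on `n ≥ 5` vertices with at most `n + 1` edges. The constant
`11` is what the crude count for `n = 5` gives. The bound is not sharp for small `n`, but the gain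
`n - 6` in the contraction step makes up for that when `n = 8` is reached. -/
theorem SimpleGraph.numConnectedSets_le_add_max (n : ℕ) (hn : 5 ≤ n) :
    ∀ (V : Type*) [Finite V] (G : SimpleGraph V), Nat.card V = n → G.Connected →
      G.edgeSet.ncard ≤ n + 1 → G.numConnectedSets ≤ 2 ^ (n - 1) + max 11 (n + 2) := by
  induction n, hn using Nat.le_induction with
  | base =>
    intro V _ G hV _ hE
    -- `27 = 2 ^ 5 - 1 - (10 - 6)`: the empty set and at least four non-adjacent pairs are excluded.
    have h := G.numConnectedSets_add_choose_two_lt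
    rw [hV, show Nat.choose 5 2 = 10 from rfl] at h
    norm_num
    omega
  | succ n hn ih =>
    intro V _ G hV hG hE
    by_cases hdom : ∃ u, G.IsDominatingVertex u
    · obtain ⟨u, hu⟩ := hdom
      have h := hu.numConnectedSets_le (by rwa [hV])
      rw [hV] at h
      omega
    · obtain ⟨b, H, hH, hHE, h⟩ := exists_contraction_of_not_isDominatingVertex hG
        (by omega) (by rwa [hV]) (not_exists.1 hdom)
      have h' := ih _ H (by rw [Nat.card_subtype_ne, hV]; rfl) hH (by rwa [hV] at hHE)
      rw [hV] at h
      have h2 : 2 ^ (n + 1 - 1) = 2 ^ (n - 1) + 2 ^ (n - 1) := by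
        rw [← two_mul, ← pow_succ']
        congr 1
        omega
      have h3 : n + 1 - 2 = n - 1 := rfl
      rw [h3] at h
      omega

/-- For `n ≥ 8`, the bound for `n - 1` vertices and the gain `n - 6` of one contraction step give at
most the number of connected sets of `bicyclicR n`. -/
theorem SimpleGraph.numConnectedSets_le_of_not_isDominatingVertex {V : Type*} [Finite V]
    {G : SimpleGraph V} (hG : G.Connected) {n : ℕ} (hn : 8 ≤ n) (hV : Nat.card V = n)
    (hE : G.edgeSet.ncard ≤ n + 1) (hdom : ∀ u, ¬ G.IsDominatingVertex u) :
    G.numConnectedSets ≤ 2 ^ (n - 1) + n + 1 := by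
  obtain ⟨b, H, hH, hHE, h⟩ := exists_contraction_of_not_isDominatingVertex hG
    (by omega) (by rwa [hV]) hdom
  have h' := numConnectedSets_le_add_max (n - 1) (by omega) _ H (by rw [Nat.card_subtype_ne, hV])
    hH (by omega)
  rw [hV] at h
  have h2 : 2 ^ (n - 1) = 2 ^ (n - 2) + 2 ^ (n - 2) := by
    rw [← two_mul, ← pow_succ']
    congr 1
    omega
  have h3 : n - 1 - 1 = n - 2 := rfl
  rw [h3] at h'
  omega

/-! ### The extremal bicyclic graphs -/

theorem mainTheorem2 (n : ℕ) (hn : 8 ≤ n) :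
    (bicyclicB n).IsBicyclic ∧ (bicyclicR n).IsBicyclic ∧
    (bicyclicB n).numConnectedSets = 2 ^ (n - 1) + n + 2 ∧
    (bicyclicR n).numConnectedSets = 2 ^ (n - 1) + n + 1 ∧
    ∀ (V : Type*) [Finite V] (G : SimpleGraph V), Nat.card V = n → G.IsBicyclic →
      G.numConnectedSets ≤ (bicyclicB n).numConnectedSets ∧
      (G.numConnectedSets = (bicyclicB n).numConnectedSets ↔ Nonempty (G ≃g bicyclicB n)) ∧
      (¬ Nonempty (G ≃g bicyclicB n) →
        G.numConnectedSets ≤ (bicyclicR n).numConnectedSets) := by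
  have hB := numConnectedSets_bicyclicB (n := n) (by omega)
  have hR := numConnectedSets_bicyclicR (n := n) (by omega)
  refine ⟨isBicyclic_bicyclicB (by omega), isBicyclic_bicyclicR (by omega), hB, hR, ?_⟩
  intro V _ G hV ⟨hG, hE⟩
  rw [hV] at hE
  have hiso : Nonempty (G ≃g bicyclicB n) →
      G.numConnectedSets = (bicyclicB n).numConnectedSets := fun ⟨e⟩ =>
    le_antisymm (Iso.numConnectedSets_le e) (Iso.numConnectedSets_le e.symm)
  have hnot : ¬ Nonempty (G ≃g bicyclicB n) →
      G.numConnectedSets ≤ (bicyclicR n).numConnectedSets := by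
    intro hni
    rw [hR]
    by_cases hdom : ∃ u, G.IsDominatingVertex u
    · obtain ⟨u, hu⟩ := hdom
      exact ((hu.nonempty_iso_or_numConnectedSets_eq (by omega) hV hE).resolve_left hni).le
    · exact numConnectedSets_le_of_not_isDominatingVertex hG hn hV hE.le (not_exists.1 hdom)
  refine ⟨?_, ⟨fun h => ?_, hiso⟩, hnot⟩
  · by_cases h : Nonempty (G ≃g bicyclicB n)
    · exact (hiso h).le
    · have := hnot h
      omega
  · by_contra hni
    have := hnot hni
    omega
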